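/- For topological spaces $Z,Y$ say that $Z\times Y$ has UU (the uniquely universal property) if there is an open set $U\subseteq Z\times Y$ such that for every open $W\subseteq Y$ there is exactly one $z\in Z$ with $U_z=\{y\in Y:(z,y)\in U\}=W$; such a $U$ is said to witness UU for $Z\times Y$. Here $\omega^\omega$ is Baire space. Let $X$ be a countable metric space that is not compact. Then: (1) $\omega^\omega\times X$ has UU. (2) $X$ has a countable basis $\mathcal B$ of open sets that contains $\emptyset$, is closed under finite unions, and is such that $X\setminus B$ is infinite for every $B\in\mathcal B$. (3) Let $\mathcal B$ be any basis as in (2). Let $\mathbb P$ be the set of pairs $p=(B_p,F_p)$ with $B_p\in\mathcal B$, $F_p\subseteq X$ finite and $B_p\cap F_p=\emptyset$, partially ordered by $p\le q$ iff $B_q\subseteq B_p$ and $F_q\subseteq F_p$; write $p\perp q$ if no $r\in\mathbb P$ satisfies $r\le p$ and $r\le q$. Call $G\subseteq\mathbb P$ a good filter if (i) $p\le q$ and $p\in G$ imply $q\in G$; (ii) for all $p,q\in G$ there is $r\in G$ with $r\le p$ and $r\le q$; (iii) for every $x\in X$ there is $p\in G$ with $x\in B_p\cup F_p$; (iv) for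 every $p\in\mathbb P$ either $p\in G$ or there is $q\in G$ with $p\perp q$. Let $\mathcal G$ be the set of good filters, with the subspace topology from $\mathcal P(\mathbb P)=2^{\mathbb P}$. Then $\mathbb P$ is countable; the maps $G\mapsto U_G=\bigcup\{B_p:p\in G\}$ and $U\mapsto G_U=\{p\in\mathbb P: B_p\subseteq U,\ F_p\cap U=\emptyset\}$ are mutually inverse bijections between $\mathcal G$ and the family of open subsets of $X$; the set $\{(G,x)\in\mathcal G\times X:\exists p\in G\ \ x\in B_p\}$ witnesses UU for $\mathcal G\times X$; and $\mathcal G$ is a zero-dimensional (i.e. it has a basis of clopen sets) Polish space without isolated points. In particular, $\omega^\omega\times\mathbb Q$ has UU. -/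

import Mathlib

/-- `U ⊆ X × Y` is uniquely universal for the open subsets of `Y`: it is open, and every open
`W ⊆ Y` is the section `U_x` for exactly one `x`. (Sections of an open set are open.) -/
def IsUniquelyUniversal {X Y : Type*} [TopologicalSpace X] [TopologicalSpace Y]
    (U : Set (X × Y)) : Prop :=
  IsOpen U ∧ ∀ W : Set Y, IsOpen W → ∃! x : X, {y : Y | (x, y) ∈ U} = W

/-- `X × Y` has the uniquely universal property. -/
def UU (X Y : Type*) [TopologicalSpace X] [TopologicalSpace Y] : Prop :=
  ∃ U : Set (X × Y), IsUniquelyUniversal U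

/-- A space is zero-dimensional if its clopen sets form a basis. -/
def IsZeroDimensional (X : Type*) [TopologicalSpace X] : Prop :=
  TopologicalSpace.IsTopologicalBasis {s : Set X | IsClopen s}

/-- Countable bases that contain the empty set, are closed under finite unions, and whose members
all have infinite complement. -/
structure IsCodingBasis {X : Type*} [TopologicalSpace X] (𝓑 : Set (Set X)) : Prop where
  isBasis : TopologicalSpace.IsTopologicalBasis 𝓑
  countable : 𝓑.Countable
  empty_mem : ∅ ∈ 𝓑
  union_mem : ∀ B ∈ 𝓑, ∀ C ∈ 𝓑, B ∪ C ∈ 𝓑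
  infinite_compl : ∀ B ∈ 𝓑, Bᶜ.Infinite

/-- The conditions `(B, F)`: `B ∈ 𝓑`, and `F` is a finite set disjoint from `B`. -/
@[ext]
structure Condition {X : Type*} (𝓑 : Set (Set X)) where
  B : Set X
  F : Finset X
  mem : B ∈ 𝓑
  disj : Disjoint B (F : Set X)

namespace Condition

variable {X : Type*} {𝓑 : Set (Set X)}

/-- `p ≤ q` iff `B_q ⊆ B_p` and `F_q ⊆ F_p`. -/
instance : PartialOrder (Condition 𝓑) where
  le p q := q.B ⊆ p.B ∧ q.F ⊆ p.F
  le_refl _ := ⟨subset_rfl, subset_rfl⟩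
  le_trans _ _ _ h₁ h₂ := ⟨h₂.1.trans h₁.1, h₂.2.trans h₁.2⟩
  le_antisymm _ _ h₁ h₂ :=
    Condition.ext (Set.Subset.antisymm h₂.1 h₁.1) (Finset.Subset.antisymm h₂.2 h₁.2)

/-- Two conditions are incompatible if they have no common lower bound. -/
def Incompatible (p q : Condition 𝓑) : Prop :=
  ¬ ∃ r : Condition 𝓑, r ≤ p ∧ r ≤ q

end Condition

/-- Good filters on the poset of conditions. -/
structure IsGoodFilter {X : Type*} {𝓑 : Set (Set X)} (G : Set (Condition 𝓑)) : Prop where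
  upward : ∀ p q, p ≤ q → p ∈ G → q ∈ G
  directed : ∀ p ∈ G, ∀ q ∈ G, ∃ r ∈ G, r ≤ p ∧ r ≤ q
  decides : ∀ x : X, ∃ p ∈ G, x ∈ p.B ∪ (p.F : Set X)
  mem_or_incompatible : ∀ p, p ∈ G ∨ ∃ q ∈ G, p.Incompatible q

/-- The type of good filters. -/
def GoodFilter {X : Type*} (𝓑 : Set (Set X)) : Type _ :=
  {G : Set (Condition 𝓑) // IsGoodFilter G}

namespace GoodFilter

variable {X : Type*} {𝓑 : Set (Set X)}

open Classical in
/-- The characteristic function of a good filter, a point of `2^ℙ`. -/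
noncomputable def char (G : GoodFilter 𝓑) : Condition 𝓑 → Bool :=
  fun p => decide (p ∈ G.1)

/-- The subspace topology from the power set of the poset, identified with `2^ℙ` (product
topology, discrete factors). -/
noncomputable instance : TopologicalSpace (GoodFilter 𝓑) :=
  TopologicalSpace.induced char inferInstance

/-- `U_G`, the union of the `B_p` with `p ∈ G`. -/
def openSet (G : GoodFilter 𝓑) : Set X :=
  ⋃ p ∈ G.1, p.B

end GoodFilter

/-- `G_U`, the set of conditions `p` with `B_p ⊆ U` and `F_p ∩ U = ∅`. -/
def codeSet {X : Type*} (𝓑 : Set (Set X)) (U : Set X) : Set (Condition 𝓑) :=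
  {p | p.B ⊆ U ∧ (p.F : Set X) ∩ U = ∅}

/-!
The conditions in a good filter decide, for every `x`, whether `x` belongs to the coded open set
`U`, and a condition `(B, F)` in the filter says exactly that `B ⊆ U` and `F ∩ U = ∅`; so good
filters are the same as open sets. By the last clause in the definition of a good filter the sets
`{G | p ∈ G}` form a clopen basis, and the four clauses are `Gδ` conditions on a point of `2^ℙ`. A
basic set is never a singleton, since `B` and `Fᶜ` are both coded in it.

A coding basis comes from a filter `f` without cluster points: take the sets `B` with `Bᶜ ∈ f` in
a countable basis closed under finite unions. If `Bᶜ` were finite, it would be a compact member of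
`f`.

It remains to map Baire space continuously and bijectively onto a nonempty zero-dimensional perfect
Polish space. A Cantor scheme does this once every nonempty perfect set `A` can be split into
infinitely many small nonempty perfect sets. One piece is `C = closure (A ∩ V)` for a small open
set `V` chosen so that `C` is not open in `A`: take every other one of a sequence of annuli, all
meeting `A`, that shrink to a point of `A`. Then `A \ C` is a disjoint union of small relatively
clopen sets, and infinitely many of these are nonempty because `A \ C` is not closed.
-/

open Set Function Filter Topology TopologicalSpace

theorem polishSpace_of_isEmbedding_of_isGδ_range {α β : Type*} [TopologicalSpace α]
    [TopologicalSpace β] [PolishSpace β] {f : α → β} (hf : IsEmbedding f)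
    (hrange : IsGδ (range f)) : PolishSpace α := by
  obtain ⟨U, hU, hrange⟩ := isGδ_iff_eq_iInter_nat.1 hrange
  have (i : ℕ) : PolishSpace (U i) := (hU i).polishSpace
  have hmem (x : α) (i : ℕ) : f x ∈ U i := mem_iInter.1 (hrange ▸ mem_range_self x) i
  let g : α → ∀ i, U i := fun x i => ⟨f x, hmem x i⟩
  have hg : Continuous g := by have := hf.continuous; fun_prop
  have hg_range : range g = {z | ∀ i, (z i : β) = z 0} := by
    refine Subset.antisymm (range_subset_iff.2 fun _ _ => rfl) fun z hz => ?_
    obtain ⟨x, hx⟩ : (z 0 : β) ∈ range f :=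
      hrange ▸ mem_iInter.2 fun i => hz i ▸ (z i).2
    exact ⟨x, funext fun i => Subtype.ext (hx.trans (hz i).symm)⟩
  have hg_embedding : IsEmbedding g :=
    .of_comp hg (continuous_subtype_val.comp (continuous_apply 0)) hf
  refine IsClosedEmbedding.polishSpace ⟨hg_embedding, ?_⟩
  simp only [hg_range, ofPred_forall]
  exact isClosed_iInter fun i => isClosed_eq (by fun_prop) (by fun_prop)

section

variable {α β : Type*}

theorem exists_forall_mem_res {S : List β → Set α} (hcons : ∀ l, S l ⊆ ⋃ b, S (b :: l)) {y : α}
    (hy : y ∈ S []) : ∃ x : ℕ → β, ∀ n, y ∈ S (PiNat.res x n) := by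
  choose b hb using fun l : {l // y ∈ S l} => mem_iUnion.1 (hcons l l.2)
  let branch : ℕ → {l // y ∈ S l} := fun n => Nat.rec ⟨[], hy⟩ (fun _ l => ⟨b l :: l, hb l⟩) n
  refine ⟨fun n => b (branch n), fun n => ?_⟩
  have hres : PiNat.res (fun n => b (branch n)) n = (branch n).1 := by
    induction n with
    | zero => rfl
    | succ n ih => rw [PiNat.res_succ, ih]
  exact hres ▸ (branch n).2

variable [MetricSpace α] [CompleteSpace α]

theorem exists_continuous_bijective_of_cantorScheme [TopologicalSpace β] [DiscreteTopology β]
    {S : List β → Set α} (hnil : S [] = univ) (hcons : ∀ l, ⋃ b, S (b :: l) = S l)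
    (hdisj : CantorScheme.Disjoint S) (hclosed : ∀ l, IsClosed (S l))
    (hne : ∀ l, (S l).Nonempty) (hdiam : CantorScheme.VanishingDiam S) :
    ∃ f : (ℕ → β) → α, Continuous f ∧ Bijective f := by
  have hanti : CantorScheme.Antitone S := fun l b =>
    (subset_iUnion (fun b => S (b :: l)) b).trans (hcons l).subset
  have hdom : (CantorScheme.inducedMap S).1 = univ :=
    (hanti.closureAntitone hclosed).map_of_vanishingDiam hdiam hne
  let toDom (x : ℕ → β) : (CantorScheme.inducedMap S).1 := ⟨x, hdom ▸ mem_univ x⟩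
  refine ⟨fun x => (CantorScheme.inducedMap S).2 (toDom x),
    hdiam.map_continuous.comp (continuous_id.subtype_mk _),
    fun x x' h => congrArg Subtype.val (hdisj.map_injective h), fun y => ?_⟩
  obtain ⟨x, hx⟩ := exists_forall_mem_res (fun l => (hcons l).superset) (hnil ▸ mem_univ y)
  refine ⟨x, eq_of_forall_dist_le fun ε hε => ?_⟩
  obtain ⟨n, hn⟩ := hdiam.dist_lt ε hε x
  exact (hn _ (CantorScheme.map_mem (toDom x) n) y (hx n)).le

theorem exists_continuous_bijective_of_forall_exists_partition {𝓒 : Set (Set α)}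
    (huniv : univ ∈ 𝓒) (hclosed : ∀ A ∈ 𝓒, IsClosed A) (hne : ∀ A ∈ 𝓒, A.Nonempty)
    (hpart : ∀ A ∈ 𝓒, ∀ ε : ENNReal, 0 < ε → ∃ P : ℕ → Set α,
      Pairwise (Disjoint on P) ∧ ⋃ n, P n = A ∧ ∀ n, P n ∈ 𝓒 ∧ Metric.ediam (P n) ≤ ε) :
    ∃ f : (ℕ → ℕ) → α, Continuous f ∧ Bijective f := by
  choose P hdisj hunion hP using fun (A : 𝓒) (k : ℕ) =>
    hpart A A.2 (k : ENNReal)⁻¹ (ENNReal.inv_pos.2 (ENNReal.natCast_ne_top k))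
  let T : List ℕ → 𝓒 := fun l =>
    List.rec ⟨univ, huniv⟩ (fun n l A => ⟨P A l.length n, (hP A l.length n).1⟩) l
  have hT (l : List ℕ) : IsClosed (T l).1 ∧ (T l).1.Nonempty :=
    ⟨hclosed _ (T l).2, hne _ (T l).2⟩
  refine exists_continuous_bijective_of_cantorScheme (S := fun l => (T l).1) rfl
    (fun l => hunion (T l) l.length) (fun l => hdisj (T l) l.length)
    (fun l => (hT l).1) (fun l => (hT l).2) fun x => ?_
  rw [← tendsto_add_atTop_iff_nat 1]
  refine tendsto_of_tendsto_of_tendsto_of_le_of_le tendsto_const_nhds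
    ENNReal.tendsto_inv_nat_nhds_zero (fun _ => zero_le) fun n => ?_
  exact (hP (T (PiNat.res x n)) (PiNat.res x n).length (x n)).2.trans_eq
    (by rw [PiNat.res_length])

end

section

theorem exists_disjoint_isOpen_mem_closure_of_isGLB {R : Type*} [LinearOrder R]
    [TopologicalSpace R] [OrderTopology R] {s : Set R} {a : R} [IsCountablyGenerated (𝓝 a)]
    (hs : IsGLB s a) (ha : a ∉ s) (hne : s.Nonempty) :
    ∃ V W : Set R, IsOpen V ∧ IsOpen W ∧ Disjoint V W ∧
      a ∈ closure (s ∩ V) ∧ a ∈ closure (s ∩ W) := by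
  obtain ⟨u, hu, -, hlim, hus⟩ := hs.exists_seq_strictAnti_tendsto_of_notMem ha hne
  let J : ℕ → Set R := fun k => Ioo (u (2 * (k + 1))) (u (2 * k))
  have hJ : Pairwise (Disjoint on J) :=
    (hu.antitone.comp_monotone fun _ _ h => Nat.mul_le_mul_left 2 h).pairwise_disjoint_on_Ioo_succ
  have hopen (φ : ℕ → ℕ) : IsOpen (⋃ k, J (φ k)) := isOpen_iUnion fun _ => isOpen_Ioo
  have hacc {φ : ℕ → ℕ} (hφ : ∀ k, k ≤ φ k) : a ∈ closure (s ∩ ⋃ k, J (φ k)) := by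
    have hindex : Tendsto (fun k => 2 * φ k + 1) atTop atTop :=
      tendsto_atTop_mono (fun k => show k ≤ _ by have := hφ k; omega) tendsto_id
    refine mem_closure_of_tendsto (hlim.comp hindex) (.of_forall fun k => ⟨hus _, ?_⟩)
    exact mem_iUnion.2 ⟨k, hu (Nat.lt_succ_self (2 * φ k + 1)), hu (Nat.lt_succ_self (2 * φ k))⟩
  refine ⟨_, _, hopen (2 * ·), hopen (2 * · + 1), ?_, hacc fun k => by omega,
    hacc fun k => by omega⟩
  simp only [disjoint_iUnion_left, disjoint_iUnion_right]
  exact fun i j => hJ (by omega)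

variable {α : Type*} [MetricSpace α] {A : Set α}

theorem exists_disjoint_isOpen_mem_closure_of_accPt {x : α} (hx : AccPt x (𝓟 A)) :
    ∃ V W : Set α, IsOpen V ∧ IsOpen W ∧ Disjoint V W ∧
      x ∈ closure (A ∩ V) ∧ x ∈ closure (A ∩ W) := by
  let s : Set ℝ := (dist · x) '' (A \ {x})
  have hxA : x ∈ closure (A \ {x}) := accPt_principal_iff_clusterPt.1 hx |>.mem_closure
  have hdist : Continuous (dist · x) := continuous_id.dist continuous_const
  have hs : IsGLB s 0 := by
    refine isGLB_of_mem_closure ?_ ?_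
    · rintro _ ⟨y, -, rfl⟩
      exact dist_nonneg
    · simpa using mem_closure_image hdist.continuousAt hxA
  have h0 : (0 : ℝ) ∉ s := by
    rintro ⟨y, hy, hyx⟩
    exact hy.2 (dist_eq_zero.1 hyx)
  obtain ⟨V, W, hV, hW, hVW, h0V, h0W⟩ := exists_disjoint_isOpen_mem_closure_of_isGLB hs h0
    ((closure_nonempty_iff.1 ⟨x, hxA⟩).image _)
  have hpull {T : Set ℝ} (hT : (0 : ℝ) ∈ closure (s ∩ T)) :
      x ∈ closure (A ∩ (dist · x) ⁻¹' T) := by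
    refine Metric.mem_closure_iff.2 fun ε hε => ?_
    obtain ⟨_, ⟨⟨y, hy, rfl⟩, hyT⟩, hyε⟩ := Metric.mem_closure_iff.1 hT ε hε
    refine ⟨y, ⟨hy.1, hyT⟩, ?_⟩
    simpa [dist_comm] using hyε
  exact ⟨_, _, hV.preimage hdist, hW.preimage hdist, hVW.preimage _, hpull h0V, hpull h0W⟩

theorem exists_isOpen_perfect_sdiff_not_isClosed_inter (hA : Perfect A) (hne : A.Nonempty)
    {ε : ENNReal} (hε : 0 < ε) :
    ∃ U : Set α, IsOpen U ∧ Perfect (A \ U) ∧ (A \ U).Nonempty ∧ Metric.ediam (A \ U) ≤ ε ∧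
      ¬ IsClosed (A ∩ U) := by
  obtain ⟨x, hxA⟩ := hne
  obtain ⟨V, W, hV, hW, hVW, hxV, hxW⟩ :=
    exists_disjoint_isOpen_mem_closure_of_accPt (hA.acc x hxA)
  let D : Set α := Metric.eball x (ε / 2) ∩ V ∩ A
  have hxD : x ∈ closure D := by
    rw [inter_comm] at hxV
    simpa only [D, inter_assoc] using Metric.isOpen_eball.inter_closure
      ⟨Metric.mem_eball_self (ENNReal.half_pos hε.ne'), hxV⟩
  have hDA : A \ (closure D)ᶜ = closure D := by
    rw [sdiff_compl, inter_eq_right]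
    exact hA.closed.closure_subset_iff.2 inter_subset_right
  refine ⟨(closure D)ᶜ, isClosed_closure.isOpen_compl, ?_, ?_, ?_, fun hclosed => ?_⟩
  · rw [hDA]
    exact (hA.acc.open_inter (Metric.isOpen_eball.inter hV)).perfect_closure
  · rw [hDA]
    exact ⟨x, hxD⟩
  · rw [hDA, Metric.ediam_closure]
    calc Metric.ediam D ≤ Metric.ediam (Metric.eball x (ε / 2)) :=
          Metric.ediam_mono fun y hy => hy.1.1
      _ ≤ 2 * (ε / 2) := Metric.ediam_eball_le
      _ = ε := ENNReal.mul_div_cancel two_ne_zero ENNReal.ofNat_ne_top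
  · have hWD : W ⊆ (closure D)ᶜ := subset_compl_iff_disjoint_right.2
      ((hVW.symm.mono_right fun y hy => hy.1.2).closure_right hW)
    exact (hclosed.closure_subset_iff.2 (inter_subset_inter_right A hWD) hxW).2 hxD

end

namespace IsZeroDimensional

variable {α : Type*}

theorem exists_disjoint_clopen_iUnion_eq [PseudoEMetricSpace α] [SecondCountableTopology α]
    (hα : IsZeroDimensional α) {U : Set α} (hU : IsOpen U) {ε : ENNReal} (hε : 0 < ε) :
    ∃ V : ℕ → Set α, Pairwise (Disjoint on V) ∧ ⋃ n, V n = U ∧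
      ∀ n, IsClopen (V n) ∧ Metric.ediam (V n) ≤ ε := by
  let 𝓥 : Set (Set α) := {V | V ⊆ U ∧ IsClopen V ∧ Metric.ediam V ≤ ε}
  have h𝓥 : ⋃₀ 𝓥 = U := by
    refine Subset.antisymm (sUnion_subset fun V hV => hV.1) fun x hx => ?_
    obtain ⟨V, hV, hxV, hVsub⟩ := hα.exists_subset_of_mem_open
      (show x ∈ U ∩ Metric.eball x (ε / 2) from
        ⟨hx, Metric.mem_eball_self (ENNReal.half_pos hε.ne')⟩) (hU.inter Metric.isOpen_eball)
    refine ⟨V, ⟨fun y hy => (hVsub hy).1, hV, ?_⟩, hxV⟩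
    calc Metric.ediam V ≤ Metric.ediam (Metric.eball x (ε / 2)) :=
          Metric.ediam_mono fun y hy => (hVsub hy).2
      _ ≤ 2 * (ε / 2) := Metric.ediam_eball_le
      _ = ε := ENNReal.mul_div_cancel two_ne_zero ENNReal.ofNat_ne_top
  obtain ⟨𝓣, h𝓣, h𝓣𝓥, h𝓣U⟩ := isOpen_sUnion_countable 𝓥 fun V hV => hV.2.1.isOpen
  obtain ⟨V, hV⟩ := (h𝓣.insert ∅).exists_eq_range (insert_nonempty _ _)
  have hmem (n : ℕ) : V n ∈ 𝓥 := by
    have : insert ∅ 𝓣 ⊆ 𝓥 := insert_subset ⟨empty_subset _, isClopen_empty, by simp⟩ h𝓣𝓥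
    exact this (hV ▸ mem_range_self n)
  refine ⟨disjointed V, disjoint_disjointed V, ?_, fun n => ?_⟩
  · rw [iUnion_disjointed, ← sUnion_range, ← hV, sUnion_insert, empty_union, h𝓣U, h𝓥]
  · refine disjointedRec (p := fun t => IsClopen t ∧ Metric.ediam t ≤ ε) (fun t i ht => ?_)
      (hmem n).2
    exact ⟨ht.1.diff (hmem i).2.1, (Metric.ediam_mono sdiff_subset).trans ht.2⟩

theorem exists_perfect_partition [MetricSpace α] [SecondCountableTopology α]
    (hα : IsZeroDimensional α) {A : Set α} (hA : Perfect A) (hne : A.Nonempty) {ε : ENNReal}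
    (hε : 0 < ε) :
    ∃ P : ℕ → Set α, Pairwise (Disjoint on P) ∧ ⋃ n, P n = A ∧
      ∀ n, (Perfect (P n) ∧ (P n).Nonempty) ∧ Metric.ediam (P n) ≤ ε := by
  obtain ⟨U, hU, hperf, hneU, hdiam, hnot⟩ :=
    exists_isOpen_perfect_sdiff_not_isClosed_inter hA hne hε
  obtain ⟨V, hVdisj, hVU, hV⟩ := hα.exists_disjoint_clopen_iUnion_eq hU hε
  let 𝓠 : Set (Set α) := range (fun n => A ∩ V n) \ {∅}
  have h𝓠 : ⋃₀ 𝓠 = A ∩ U := by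
    rw [sUnion_sdiff_singleton_empty, sUnion_range, ← inter_iUnion, hVU]
  have h𝓠_infinite : 𝓠.Infinite := fun hfin => hnot <| by
    rw [← h𝓠, sUnion_eq_biUnion]
    refine hfin.isClosed_biUnion ?_
    rintro _ ⟨⟨n, rfl⟩, -⟩
    exact hA.closed.inter (hV n).1.isClosed
  have h𝓠_disjoint : 𝓠.PairwiseDisjoint id := by
    rintro _ ⟨⟨n, rfl⟩, -⟩ _ ⟨⟨m, rfl⟩, -⟩ hnm
    have : n ≠ m := fun h => hnm (h ▸ rfl)
    exact (hVdisj this).mono inter_subset_right inter_subset_right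
  let 𝓡 : Set (Set α) := insert (A \ U) 𝓠
  have h𝓡 : ∀ P ∈ 𝓡, (Perfect P ∧ P.Nonempty) ∧ Metric.ediam P ≤ ε := by
    rintro _ (rfl | ⟨⟨n, rfl⟩, hn⟩)
    · exact ⟨⟨hperf, hneU⟩, hdiam⟩
    · refine ⟨⟨⟨hA.closed.inter (hV n).1.isClosed, ?_⟩, nonempty_iff_ne_empty.2 hn⟩,
        (Metric.ediam_mono inter_subset_right).trans (hV n).2⟩
      change Preperfect (A ∩ V n)
      rw [inter_comm]
      exact hA.acc.open_inter (hV n).1.isOpen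
  have h𝓡_disjoint : 𝓡.PairwiseDisjoint id := h𝓠_disjoint.insert fun Q hQ _ =>
    disjoint_sdiff_left.mono_right ((subset_sUnion_of_mem hQ).trans (h𝓠 ▸ inter_subset_right))
  have : Infinite 𝓡 := (h𝓠_infinite.mono (subset_insert _ _)).to_subtype
  have : Countable 𝓡 := (((countable_range _).mono sdiff_subset).insert _).to_subtype
  obtain ⟨e⟩ := nonempty_equiv_of_countable (α := ℕ) (β := 𝓡)
  refine ⟨fun n => e n, fun n m hnm => h𝓡_disjoint (e n).2 (e m).2 fun h => ?_, ?_,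
    fun n => h𝓡 _ (e n).2⟩
  · exact hnm (e.injective (Subtype.ext h))
  · rw [e.surjective.iUnion_comp (fun P : 𝓡 => (P : Set α)), ← sUnion_eq_iUnion, sUnion_insert,
      h𝓠, sdiff_union_inter]

theorem exists_continuous_bijective_nat_nat [TopologicalSpace α] [PolishSpace α] [PerfectSpace α]
    [Nonempty α] (hα : IsZeroDimensional α) :
    ∃ f : (ℕ → ℕ) → α, Continuous f ∧ Bijective f := by
  let := upgradeIsCompletelyMetrizable α
  exact exists_continuous_bijective_of_forall_exists_partition
    (𝓒 := {A | Perfect A ∧ A.Nonempty}) ⟨PerfectSpace.univ_perfect α, univ_nonempty⟩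
    (fun _ hA => hA.1.closed) (fun _ hA => hA.2)
    fun _ hA _ hε => hα.exists_perfect_partition hA.1 hA.2 hε

end IsZeroDimensional

theorem IsUniquelyUniversal.preimage {Z Z' Y : Type*} [TopologicalSpace Z] [TopologicalSpace Z']
    [TopologicalSpace Y] {U : Set (Z × Y)} (hU : IsUniquelyUniversal U) {f : Z' → Z}
    (hf : Continuous f) (hbij : Bijective f) : IsUniquelyUniversal (Prod.map f id ⁻¹' U) := by
  refine ⟨hU.1.preimage (hf.prodMap continuous_id), fun W hW => ?_⟩
  obtain ⟨z, hz, huniq⟩ := hU.2 W hW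
  obtain ⟨w, rfl⟩ := hbij.2 z
  exact ⟨w, hz, fun w' hw' => hbij.1 (huniq (f w') hw')⟩

theorem exists_countable_isTopologicalBasis_union_mem (X : Type*) [TopologicalSpace X]
    [SecondCountableTopology X] :
    ∃ 𝓑 : Set (Set X), 𝓑.Countable ∧ IsTopologicalBasis 𝓑 ∧ ∅ ∈ 𝓑 ∧
      ∀ B ∈ 𝓑, ∀ C ∈ 𝓑, B ∪ C ∈ 𝓑 := by
  refine ⟨sUnion '' {S | S.Finite ∧ S ⊆ countableBasis X}, ?_, ?_,
    ⟨∅, ⟨finite_empty, empty_subset _⟩, sUnion_empty⟩, ?_⟩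
  · exact (countable_ofPred_finite_subset (countable_countableBasis X)).image _
  · refine (isBasis_countableBasis X).of_isOpen_of_subset ?_ fun V hV => ?_
    · rintro _ ⟨S, ⟨-, hS⟩, rfl⟩
      exact isOpen_sUnion fun V hV => isOpen_of_mem_countableBasis (hS hV)
    · exact ⟨{V}, ⟨finite_singleton V, singleton_subset_iff.2 hV⟩, sUnion_singleton V⟩
  · rintro _ ⟨S, ⟨hS, hSX⟩, rfl⟩ _ ⟨T, ⟨hT, hTX⟩, rfl⟩
    exact ⟨S ∪ T, ⟨hS.union hT, union_subset hSX hTX⟩, sUnion_union S T⟩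

theorem exists_isCodingBasis {X : Type*} [TopologicalSpace X] [SecondCountableTopology X]
    (hX : ¬ CompactSpace X) : ∃ 𝓑 : Set (Set X), IsCodingBasis 𝓑 := by
  obtain ⟨f, hf, hdisj⟩ : ∃ f : Filter X, f.NeBot ∧ ∀ x, Disjoint (𝓝 x) f := by
    rw [← isCompact_univ_iff, IsCompact] at hX
    push Not at hX
    simpa [clusterPt_iff_not_disjoint] using hX
  obtain ⟨𝓐, h𝓐, hbasis, hempty, hunion⟩ := exists_countable_isTopologicalBasis_union_mem X
  refine ⟨{B ∈ 𝓐 | Bᶜ ∈ f}, ?_, h𝓐.mono (sep_subset _ _), ⟨hempty, ?_⟩, ?_, ?_⟩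
  · refine isTopologicalBasis_of_isOpen_of_nhds (fun B hB => hbasis.isOpen hB.1) fun x U hx hU => ?_
    obtain ⟨s, hs, t, ht, hst⟩ := Filter.disjoint_iff.1 (hdisj x)
    obtain ⟨B, hB, hxB, hBUs⟩ := hbasis.mem_nhds_iff.1 (inter_mem (hU.mem_nhds hx) hs)
    refine ⟨B, ⟨hB, mem_of_superset ht ?_⟩, hxB, hBUs.trans inter_subset_left⟩
    exact (hst.mono_left (hBUs.trans inter_subset_right)).subset_compl_left
  · rw [compl_empty]
    exact univ_mem
  · rintro B ⟨hB, hBf⟩ C ⟨hC, hCf⟩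
    refine ⟨hunion B hB C hC, ?_⟩
    rw [compl_union]
    exact inter_mem hBf hCf
  · rintro B ⟨-, hBf⟩ hfin
    obtain ⟨x, -, hx⟩ := hfin.isCompact (le_principal_iff.2 hBf)
    exact hx.ne (hdisj x).eq_bot

namespace Condition

variable {X : Type*} {𝓑 : Set (Set X)}

theorem countable_of_countable [Countable X] (h𝓑 : 𝓑.Countable) : Countable (Condition 𝓑) := by
  have := h𝓑.to_subtype
  refine Injective.countable (f := fun p : Condition 𝓑 => ((⟨p.B, p.mem⟩ : 𝓑), p.F)) ?_
  intro p q h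
  simp only [Prod.mk.injEq, Subtype.mk.injEq] at h
  exact Condition.ext h.1 h.2

theorem exists_le_le (hunion : ∀ B ∈ 𝓑, ∀ C ∈ 𝓑, B ∪ C ∈ 𝓑) {p q : Condition 𝓑}
    (hpq : Disjoint p.B (q.F : Set X)) (hqp : Disjoint q.B (p.F : Set X)) :
    ∃ r : Condition 𝓑, r.B = p.B ∪ q.B ∧ (r.F : Set X) = ↑p.F ∪ ↑q.F ∧ r ≤ p ∧ r ≤ q := by
  classical
  refine ⟨⟨p.B ∪ q.B, p.F ∪ q.F, hunion _ p.mem _ q.mem, ?_⟩, rfl, Finset.coe_union _ _,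
    ⟨subset_union_left, Finset.subset_union_left⟩, ⟨subset_union_right, Finset.subset_union_right⟩⟩
  rw [Finset.coe_union, disjoint_union_left, disjoint_union_right, disjoint_union_right]
  exact ⟨⟨p.disj, hpq⟩, hqp, q.disj⟩

theorem Incompatible.symm {p q : Condition 𝓑} (h : p.Incompatible q) : q.Incompatible p :=
  fun ⟨r, hq, hp⟩ => h ⟨r, hp, hq⟩

theorem incompatible_of_mem {p q : Condition 𝓑} {x : X} (hp : x ∈ p.B) (hq : x ∈ q.F) :
    p.Incompatible q :=
  fun ⟨r, hrp, hrq⟩ => disjoint_left.1 r.disj (hrp.1 hp) (hrq.2 hq)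

theorem mem_codeSet {p : Condition 𝓑} {U : Set X} :
    p ∈ codeSet 𝓑 U ↔ p.B ⊆ U ∧ Disjoint (p.F : Set X) U :=
  and_congr_right' disjoint_iff_inter_eq_empty.symm

end Condition

namespace GoodFilter

variable {X : Type*} {𝓑 : Set (Set X)}

theorem not_incompatible (G : GoodFilter 𝓑) {p q : Condition 𝓑} (hp : p ∈ G.1) (hq : q ∈ G.1) :
    ¬ p.Incompatible q := fun h =>
  have ⟨r, _, hr⟩ := G.2.directed p hp q hq
  h ⟨r, hr⟩

theorem notMem_iff_exists_incompatible (G : GoodFilter 𝓑) {p : Condition 𝓑} :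
    p ∉ G.1 ↔ ∃ q ∈ G.1, p.Incompatible q :=
  ⟨(G.2.mem_or_incompatible p).resolve_left, fun ⟨_, hq, hpq⟩ hp => G.not_incompatible hp hq hpq⟩

theorem disjoint_openSet (G : GoodFilter 𝓑) {p : Condition 𝓑} (hp : p ∈ G.1) :
    Disjoint (p.F : Set X) G.openSet := by
  simp only [openSet, disjoint_iUnion_right]
  exact fun q hq => disjoint_left.2 fun x hxp hxq =>
    G.not_incompatible hq hp (Condition.incompatible_of_mem hxq hxp)

theorem codeSet_openSet (hunion : ∀ B ∈ 𝓑, ∀ C ∈ 𝓑, B ∪ C ∈ 𝓑) (G : GoodFilter 𝓑) :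
    codeSet 𝓑 G.openSet = G.1 := by
  refine Subset.antisymm (fun p hp => ?_) fun p hp =>
    Condition.mem_codeSet.2 ⟨subset_biUnion_of_mem (u := Condition.B) hp, G.disjoint_openSet hp⟩
  obtain ⟨hB, hF⟩ := Condition.mem_codeSet.1 hp
  by_contra hpG
  obtain ⟨q, hq, hpq⟩ := G.notMem_iff_exists_incompatible.1 hpG
  obtain ⟨r, -, -, hr⟩ := Condition.exists_le_le hunion
    ((G.disjoint_openSet hq).symm.mono_left hB)
    (hF.symm.mono_left (subset_biUnion_of_mem (u := Condition.B) hq))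
  exact hpq ⟨r, hr⟩

theorem char_eq_true_iff {G : GoodFilter 𝓑} {p : Condition 𝓑} : G.char p = true ↔ p ∈ G.1 :=
  @decide_eq_true_iff _ (Classical.propDecidable _)

theorem preimage_char_eq (p : Condition 𝓑) :
    (fun G : GoodFilter 𝓑 => G.char p) ⁻¹' {true} = {G | p ∈ G.1} :=
  ext fun _ => char_eq_true_iff

theorem isEmbedding_char : IsEmbedding (char : GoodFilter 𝓑 → Condition 𝓑 → Bool) := by
  refine ⟨⟨rfl⟩, fun G H h => Subtype.ext (ext fun p => ?_)⟩
  rw [← char_eq_true_iff, h, char_eq_true_iff]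

theorem isClopen_mem (p : Condition 𝓑) : IsClopen {G : GoodFilter 𝓑 | p ∈ G.1} := by
  rw [← preimage_char_eq, ← continuous_bool_rng]
  exact (continuous_apply p).comp isEmbedding_char.continuous

theorem isTopologicalBasis_mem [Nonempty X] :
    IsTopologicalBasis (range fun p : Condition 𝓑 => {G : GoodFilter 𝓑 | p ∈ G.1}) where
  exists_subset_inter := by
    rintro _ ⟨p, rfl⟩ _ ⟨q, rfl⟩ G ⟨hp, hq⟩
    obtain ⟨r, hr, hrp, hrq⟩ := G.2.directed p hp q hq
    exact ⟨_, ⟨r, rfl⟩, hr, fun H hH => ⟨H.2.upward r p hrp hH, H.2.upward r q hrq hH⟩⟩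
  sUnion_eq := sUnion_eq_univ_iff.2 fun G =>
    have ⟨p, hp, _⟩ := G.2.decides (Classical.arbitrary X)
    ⟨_, ⟨p, rfl⟩, hp⟩
  eq_generateFrom := by
    refine le_antisymm (le_generateFrom ?_) (continuous_iff_le_induced.1 ?_)
    · rintro _ ⟨p, rfl⟩
      exact (isClopen_mem p).isOpen
    · let := generateFrom (range fun p : Condition 𝓑 => {G : GoodFilter 𝓑 | p ∈ G.1})
      have hopen (p : Condition 𝓑) : IsOpen {G : GoodFilter 𝓑 | p ∈ G.1} :=
        isOpen_generateFrom_of_mem ⟨p, rfl⟩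
      refine continuous_pi fun p => ?_
      rw [continuous_bool_rng true, preimage_char_eq]
      refine ⟨⟨?_⟩, hopen p⟩
      have hcompl : {G : GoodFilter 𝓑 | p ∈ G.1}ᶜ =
          ⋃ (q) (_ : p.Incompatible q), {G | q ∈ G.1} := by
        ext G
        simp [notMem_iff_exists_incompatible, and_comm]
      rw [hcompl]
      exact isOpen_biUnion fun q _ => hopen q

theorem isZeroDimensional [Nonempty X] : IsZeroDimensional (GoodFilter 𝓑) :=
  isTopologicalBasis_mem.of_isOpen_of_subset (fun _ hs => hs.isOpen)
    (range_subset_iff.2 isClopen_mem)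

theorem range_char : range (char : GoodFilter 𝓑 → Condition 𝓑 → Bool) =
    {c | IsGoodFilter {p | c p = true}} := by
  refine Subset.antisymm ?_ fun c hc => ⟨⟨_, hc⟩, funext fun p => Bool.decide_eq_true⟩
  rintro _ ⟨G, rfl⟩
  simp only [mem_ofPred_eq, char_eq_true_iff]
  exact G.2

theorem isGδ_range_char [Countable X] [Countable (Condition 𝓑)] :
    IsGδ (range (char : GoodFilter 𝓑 → Condition 𝓑 → Bool)) := by
  have hmem (p : Condition 𝓑) : IsClopen {c : Condition 𝓑 → Bool | c p = true} :=
    (isClopen_discrete {true}).preimage (continuous_apply p)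
  have himp (p : Condition 𝓑) {P : (Condition 𝓑 → Bool) → Prop} (hP : IsOpen {c | P c}) :
      IsOpen {c | c p = true → P c} := by
    simp only [imp_iff_not_or]
    exact (hmem p).compl.isOpen.union hP
  have hexists (P : Condition 𝓑 → Prop) :
      IsOpen {c : Condition 𝓑 → Bool | ∃ p, c p = true ∧ P p} := by
    rw [ofPred_exists]
    exact isOpen_iUnion fun p => (hmem p).isOpen.and isOpen_const
  have hgood (c : Condition 𝓑 → Bool) : IsGoodFilter {p | c p = true} ↔
      (∀ p q, p ≤ q → c p = true → c q = true) ∧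
      (∀ p q, c p = true → c q = true → ∃ r, c r = true ∧ r ≤ p ∧ r ≤ q) ∧
      (∀ x : X, ∃ p, c p = true ∧ x ∈ p.B ∪ (p.F : Set X)) ∧
      ∀ p, c p = true ∨ ∃ q, c q = true ∧ p.Incompatible q :=
    ⟨fun h => ⟨h.upward, fun p q hp => h.directed p hp q, h.decides, h.mem_or_incompatible⟩,
      fun ⟨h₁, h₂, h₃, h₄⟩ => ⟨h₁, fun p hp q => h₂ p q hp, h₃, h₄⟩⟩
  simp only [range_char, hgood, ofPred_and, ofPred_forall]
  refine .inter (.iInter fun p => .iInter fun q => .iInter fun _ => ?_) <|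
    .inter (.iInter fun p => .iInter fun q => ?_) <|
    .inter (.iInter fun x => (hexists _).isGδ) <|
    .iInter fun p => ((hmem p).isOpen.union (hexists _)).isGδ
  · exact (himp p (hmem q).isOpen).isGδ
  · exact (himp p (himp q (hexists _))).isGδ

theorem polishSpace [Countable X] [Countable (Condition 𝓑)] : PolishSpace (GoodFilter 𝓑) :=
  have : PolishSpace Bool := inferInstance
  polishSpace_of_isEmbedding_of_isGδ_range isEmbedding_char isGδ_range_char

end GoodFilter

namespace IsCodingBasis

variable {X : Type*} [TopologicalSpace X] {𝓑 : Set (Set X)}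

theorem nonempty (h𝓑 : IsCodingBasis 𝓑) : Nonempty X :=
  (h𝓑.infinite_compl ∅ h𝓑.empty_mem).nonempty.to_type

theorem isOpen_openSet (h𝓑 : IsCodingBasis 𝓑) (G : GoodFilter 𝓑) : IsOpen G.openSet :=
  isOpen_biUnion fun p _ => h𝓑.isBasis.isOpen p.mem

theorem exists_mem_codeSet_mem_B (h𝓑 : IsCodingBasis 𝓑) {U : Set X} (hU : IsOpen U) {x : X}
    (hx : x ∈ U) : ∃ p ∈ codeSet 𝓑 U, x ∈ p.B := by
  obtain ⟨B, hB, hxB, hBU⟩ := h𝓑.isBasis.exists_subset_of_mem_open hx hU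
  exact ⟨⟨B, ∅, hB, by simp⟩, ⟨hBU, by simp⟩, hxB⟩

theorem exists_mem_codeSet_mem_F (h𝓑 : IsCodingBasis 𝓑) {U : Set X} {x : X} (hx : x ∉ U) :
    ∃ p ∈ codeSet 𝓑 U, x ∈ p.F :=
  ⟨⟨∅, {x}, h𝓑.empty_mem, empty_disjoint _⟩, ⟨empty_subset _, by simpa using hx⟩,
    Finset.mem_singleton_self x⟩

theorem isGoodFilter_codeSet (h𝓑 : IsCodingBasis 𝓑) {U : Set X} (hU : IsOpen U) :
    IsGoodFilter (codeSet 𝓑 U) where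
  upward p q hpq hp := by
    rw [Condition.mem_codeSet] at hp ⊢
    exact ⟨hpq.1.trans hp.1, hp.2.mono_left (Finset.coe_subset.2 hpq.2)⟩
  directed p hp q hq := by
    rw [Condition.mem_codeSet] at hp hq
    obtain ⟨r, hB, hF, hr⟩ := Condition.exists_le_le h𝓑.union_mem
      (hq.2.symm.mono_left hp.1) (hp.2.symm.mono_left hq.1)
    refine ⟨r, Condition.mem_codeSet.2 ⟨hB ▸ union_subset hp.1 hq.1, ?_⟩, hr⟩
    exact hF ▸ disjoint_union_left.2 ⟨hp.2, hq.2⟩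
  decides x := by
    by_cases hx : x ∈ U
    · obtain ⟨p, hp, hxp⟩ := h𝓑.exists_mem_codeSet_mem_B hU hx
      exact ⟨p, hp, .inl hxp⟩
    · obtain ⟨p, hp, hxp⟩ := h𝓑.exists_mem_codeSet_mem_F hx
      exact ⟨p, hp, .inr hxp⟩
  mem_or_incompatible p := by
    refine or_iff_not_imp_left.2 fun hp => ?_
    rw [Condition.mem_codeSet, not_and_or, not_subset, not_disjoint_iff] at hp
    rcases hp with ⟨x, hxp, hx⟩ | ⟨x, hxp, hx⟩
    · obtain ⟨q, hq, hxq⟩ := h𝓑.exists_mem_codeSet_mem_F hx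
      exact ⟨q, hq, Condition.incompatible_of_mem hxp hxq⟩
    · obtain ⟨q, hq, hxq⟩ := h𝓑.exists_mem_codeSet_mem_B hU hx
      exact ⟨q, hq, (Condition.incompatible_of_mem hxq hxp).symm⟩

/-- The good filter `G_U` of an open set `U`. -/
def codeFilter (h𝓑 : IsCodingBasis 𝓑) {U : Set X} (hU : IsOpen U) : GoodFilter 𝓑 :=
  ⟨codeSet 𝓑 U, h𝓑.isGoodFilter_codeSet hU⟩

theorem openSet_codeFilter (h𝓑 : IsCodingBasis 𝓑) {U : Set X} (hU : IsOpen U) :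
    (h𝓑.codeFilter hU).openSet = U := by
  refine Subset.antisymm (iUnion₂_subset fun p hp => hp.1) fun x hx => ?_
  obtain ⟨p, hp, hxp⟩ := h𝓑.exists_mem_codeSet_mem_B hU hx
  exact mem_biUnion hp hxp

theorem isUniquelyUniversal (h𝓑 : IsCodingBasis 𝓑) :
    IsUniquelyUniversal {z : GoodFilter 𝓑 × X | ∃ p ∈ z.1.1, z.2 ∈ p.B} := by
  have hsection (G : GoodFilter 𝓑) : {x | ∃ p ∈ G.1, x ∈ p.B} = G.openSet := by
    ext x
    simp [GoodFilter.openSet]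
  refine ⟨?_, fun W hW => ⟨h𝓑.codeFilter hW, ?_, fun G hG => Subtype.ext ?_⟩⟩
  · have hunion : {z : GoodFilter 𝓑 × X | ∃ p ∈ z.1.1, z.2 ∈ p.B} =
        ⋃ p : Condition 𝓑, {G : GoodFilter 𝓑 | p ∈ G.1} ×ˢ p.B := by
      ext z
      simp
    rw [hunion]
    exact isOpen_iUnion fun p =>
      (GoodFilter.isClopen_mem p).isOpen.prod (h𝓑.isBasis.isOpen p.mem)
  · exact (hsection _).trans (h𝓑.openSet_codeFilter hW)
  · have hGW : G.openSet = W := (hsection G).symm.trans hG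
    rw [← G.codeSet_openSet h𝓑.union_mem, hGW]
    rfl

theorem nontrivial_mem [T1Space X] (h𝓑 : IsCodingBasis 𝓑) (p : Condition 𝓑) :
    {G : GoodFilter 𝓑 | p ∈ G.1}.Nontrivial := by
  have hB : IsOpen p.B := h𝓑.isBasis.isOpen p.mem
  have hF : IsOpen (p.F : Set X)ᶜ := p.F.finite_toSet.isClosed.isOpen_compl
  have hBF : p.B ⊆ (p.F : Set X)ᶜ := subset_compl_iff_disjoint_right.2 p.disj
  refine ⟨h𝓑.codeFilter hB, Condition.mem_codeSet.2 ⟨subset_rfl, p.disj.symm⟩, h𝓑.codeFilter hF,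
    Condition.mem_codeSet.2 ⟨hBF, disjoint_compl_right⟩, fun h => ?_⟩
  obtain ⟨x, hxB, hxF⟩ := (h𝓑.infinite_compl p.B p.mem).exists_notMem_finset p.F
  have hBF : p.B = (p.F : Set X)ᶜ := by
    rw [← h𝓑.openSet_codeFilter hB, h, h𝓑.openSet_codeFilter hF]
  exact hxB (hBF ▸ hxF)

theorem perfectSpace [T1Space X] (h𝓑 : IsCodingBasis 𝓑) : PerfectSpace (GoodFilter 𝓑) := by
  have := h𝓑.nonempty
  refine ⟨preperfect_iff_nhds.2 fun G _ s hs => ?_⟩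
  obtain ⟨_, ⟨p, rfl⟩, -, hps⟩ := GoodFilter.isTopologicalBasis_mem.mem_nhds_iff.1 hs
  obtain ⟨H, hH, hHG⟩ := (h𝓑.nontrivial_mem p).exists_ne G
  exact ⟨H, ⟨hps hH, mem_univ H⟩, hHG⟩

theorem uu_nat_nat [T1Space X] [Countable X] (h𝓑 : IsCodingBasis 𝓑) : UU (ℕ → ℕ) X := by
  have := h𝓑.nonempty
  have := Condition.countable_of_countable h𝓑.countable
  have := GoodFilter.polishSpace (𝓑 := 𝓑)
  have := h𝓑.perfectSpace
  have : Nonempty (GoodFilter 𝓑) := ⟨h𝓑.codeFilter isOpen_empty⟩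
  have hzero : IsZeroDimensional (GoodFilter 𝓑) := GoodFilter.isZeroDimensional
  obtain ⟨f, hf, hbij⟩ := hzero.exists_continuous_bijective_nat_nat
  exact ⟨_, h𝓑.isUniquelyUniversal.preimage hf hbij⟩

end IsCodingBasis

theorem mainTheorem5_general {X : Type*} [TopologicalSpace X] [T1Space X]
    [FirstCountableTopology X] [Countable X] (hX : ¬ CompactSpace X) :
    UU (ℕ → ℕ) X ∧
    (∃ 𝓑 : Set (Set X), IsCodingBasis 𝓑) ∧
    (∀ 𝓑 : Set (Set X), IsCodingBasis 𝓑 →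
      Countable (Condition 𝓑) ∧
      (∀ G : GoodFilter 𝓑, IsOpen G.openSet ∧ codeSet 𝓑 G.openSet = G.1) ∧
      (∀ U : Set X, IsOpen U → ∃ h : IsGoodFilter (codeSet 𝓑 U),
        GoodFilter.openSet ⟨codeSet 𝓑 U, h⟩ = U) ∧
      IsUniquelyUniversal {z : GoodFilter 𝓑 × X | ∃ p ∈ z.1.1, z.2 ∈ p.B} ∧
      PolishSpace (GoodFilter 𝓑) ∧
      IsZeroDimensional (GoodFilter 𝓑) ∧
      PerfectSpace (GoodFilter 𝓑)) := by
  have hbasis : ∃ 𝓑 : Set (Set X), IsCodingBasis 𝓑 := exists_isCodingBasis hX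
  refine ⟨hbasis.elim fun 𝓑 h𝓑 => h𝓑.uu_nat_nat, hbasis, fun 𝓑 h𝓑 => ?_⟩
  have := h𝓑.nonempty
  have hcountable : Countable (Condition 𝓑) := Condition.countable_of_countable h𝓑.countable
  exact ⟨hcountable, fun G => ⟨h𝓑.isOpen_openSet G, G.codeSet_openSet h𝓑.union_mem⟩,
    fun U hU => ⟨h𝓑.isGoodFilter_codeSet hU, h𝓑.openSet_codeFilter hU⟩, h𝓑.isUniquelyUniversal,
    GoodFilter.polishSpace, GoodFilter.isZeroDimensional, h𝓑.perfectSpace⟩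

theorem mainTheorem5 :
    (∀ (X : Type*) [MetricSpace X] [Countable X], ¬ CompactSpace X →
      UU (ℕ → ℕ) X ∧
      (∃ 𝓑 : Set (Set X), IsCodingBasis 𝓑) ∧
      (∀ 𝓑 : Set (Set X), IsCodingBasis 𝓑 →
        Countable (Condition 𝓑) ∧
        (∀ G : GoodFilter 𝓑, IsOpen G.openSet ∧ codeSet 𝓑 G.openSet = G.1) ∧
        (∀ U : Set X, IsOpen U → ∃ h : IsGoodFilter (codeSet 𝓑 U),
          GoodFilter.openSet ⟨codeSet 𝓑 U, h⟩ = U) ∧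
        IsUniquelyUniversal {z : GoodFilter 𝓑 × X | ∃ p ∈ z.1.1, z.2 ∈ p.B} ∧
        PolishSpace (GoodFilter 𝓑) ∧
        IsZeroDimensional (GoodFilter 𝓑) ∧
        PerfectSpace (GoodFilter 𝓑))) ∧
    UU (ℕ → ℕ) ℚ := by
  exact ⟨fun _ _ _ hX => mainTheorem5_general hX,
    (mainTheorem5_general (not_compactSpace_iff.2 inferInstance)).1⟩
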